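/- Let $d\ge 2$, and let $F$ and $F_0$ be probability distributions on $\mathbb{R}^d$, each having a density that is positive and bounded on every bounded subset of $\mathbb{R}^d$. Let $\mathbf x_1,\mathbf x_2,\dots$ be i.i.d. random vectors with distribution $F$, and write $\mathbf x_k=(x_{k,1},\dots,x_{k,d})$. For each $n$, let $$\mathbf u_k=\mathbf u_{k}^{(n)}=\frac1n\sum_{1\le j\le n,\ \mathbf x_j\ne\mathbf x_k}\frac{\mathbf x_k-\mathbf x_j}{\|\mathbf x_k-\mathbf x_j\|},\qquad k=1,\dots,n,$$ be the spatial ranks of the data points. For $\|\mathbf u\|<1$ let $Q_{F_0}(\mathbf u)=(Q_{F_0,1}(\mathbf u),\dots,Q_{F_0,d}(\mathbf u))$ be the spatial quantile of $F_0$, $$Q_{F_0}(\mathbf u)=\arg\min_{Q\in\mathbb{R}^d}\int\bigl\{\Phi(\mathbf u,\mathbf x-Q)-\Phi(\mathbf u,\mathbf x)\bigr\}\,dF_0(\mathbf x),\qquad \Phi(\mathbf u,\mathbf s)=\|\mathbf s\|+\langle\mathbf u,\mathbf s\rangle .$$ For $0<r<1$ and $i=1,\dots,d$ let $$S_{n,i}^{r}=\bigl\{(x_{k,i},\,Q_{F_0,i}(\mathbf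 u_k)) : 1\le k\le n,\ \|\mathbf u_k\|\le r\bigr\}\subset\mathbb{R}^2$$ be the $i$-th one-sample Q–Q plot constructed from the ranks lying in the closed ball of radius $r$ centred at the origin, and let $L(\varepsilon)\subset\mathbb{R}^2$ be the (open, Euclidean) $\varepsilon$-neighbourhood of the line $\{(x,y):y=x\}$. Then $$\lim_{n\to\infty}P\Bigl(\bigcap_{i=1}^{d}\bigl[S_{n,i}^{r}\subseteq L(\varepsilon)\bigr]\Bigr)=1\quad\text{for every } r\in(0,1)\text{ and every }\varepsilon>0$$ if and only if $F=F_0$. -/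

import Mathlib

open MeasureTheory ProbabilityTheory Filter Topology

namespace SpatialQQ

/-- `F` has a density with respect to Lebesgue measure on `ℝ^d` that is positive everywhere and
bounded on every bounded subset of `ℝ^d`. -/
def HasPosLocBddDensity {d : ℕ} (F : Measure (EuclideanSpace ℝ (Fin d))) : Prop :=
  ∃ f : EuclideanSpace ℝ (Fin d) → ℝ,
    Measurable f ∧ (∀ x, 0 < f x) ∧
    (∀ s : Set (EuclideanSpace ℝ (Fin d)), Bornology.IsBounded s → ∃ C : ℝ, ∀ x ∈ s, f x ≤ C) ∧
    F = volume.withDensity (fun x => ENNReal.ofReal (f x))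

open scoped Classical in
/-- The spatial rank of `z` with respect to the data cloud `x_1, …, x_n`:
`n⁻¹ ∑_{i : x_i ≠ z} (z - x_i) / ‖z - x_i‖`. -/
noncomputable def spatialRank {d n : ℕ} (x : Fin n → EuclideanSpace ℝ (Fin d))
    (z : EuclideanSpace ℝ (Fin d)) : EuclideanSpace ℝ (Fin d) :=
  (n : ℝ)⁻¹ • ∑ i ∈ Finset.univ.filter (fun i => x i ≠ z), ‖z - x i‖⁻¹ • (z - x i)

/-- `Φ(u, s) = ‖s‖ + ⟨u, s⟩`. -/
noncomputable def Phi {d : ℕ} (u s : EuclideanSpace ℝ (Fin d)) : ℝ :=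
  ‖s‖ + inner ℝ u s

/-- `q` minimizes `Q ↦ E {Φ(u, x - Q) - Φ(u, x)}` over `ℝ^d`, where `x` has law `F`.
The integrand is bounded in `x`, hence integrable for every probability measure `F`. -/
def IsSpatialQuantile {d : ℕ} (F : Measure (EuclideanSpace ℝ (Fin d)))
    (u q : EuclideanSpace ℝ (Fin d)) : Prop :=
  IsMinOn (fun Q => ∫ x, (Phi u (x - Q) - Phi u x) ∂F) Set.univ q

/-- The spatial quantile `Q_F(u)`, the argmin of `Q ↦ E {Φ(u, x - Q) - Φ(u, x)}`. (For `‖u‖ < 1`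
and `F` not supported on a line the minimizer exists and is unique.) -/
noncomputable def spatialQuantile {d : ℕ} (F : Measure (EuclideanSpace ℝ (Fin d)))
    (u : EuclideanSpace ℝ (Fin d)) : EuclideanSpace ℝ (Fin d) :=
  Classical.epsilon (fun q => IsSpatialQuantile F u q)

/-- The `i`-th Q–Q plot of the data `x_1, …, x_n` against `F₀`: the points
`(x_{k,i}, Q_{F₀,i}(u_k))`, where `u_k` is the spatial rank of `x_k` in the data, constructed from
those `u_k` that lie in the closed ball of radius `r` around the origin. -/
noncomputable def qqPlot {d n : ℕ} (x : Fin n → EuclideanSpace ℝ (Fin d))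
    (F₀ : Measure (EuclideanSpace ℝ (Fin d))) (r : ℝ) (i : Fin d) :
    Set (EuclideanSpace ℝ (Fin 2)) :=
  {p | ∃ k : Fin n, spatialRank x (x k) ∈ Metric.closedBall 0 r ∧
    p = !₂[x k i, spatialQuantile F₀ (spatialRank x (x k)) i]}

/-- `L(ε)`: the `ε`-neighbourhood in the Euclidean plane of the line with slope `1` and
intercept `0`. -/
def lineNhd (ε : ℝ) : Set (EuclideanSpace ℝ (Fin 2)) :=
  Metric.thickening ε {p | p 1 = p 0}

end SpatialQQ

/-!
The spatial rank `R_F(z) = ∫ (z - x) / ‖z - x‖ dF(x)` is a subgradient at `z` of the convex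
potential `φ_F(z) = ∫ (‖x - z‖ - ‖x‖) dF(x)`, and the spatial quantile `Q_F(u)` is a minimizer of
`φ_F - ⟪u, ·⟫`, that is, a point at which `u` is a subgradient of `φ_F`.

If the support of `F` is the whole space, then `φ_F` is strictly convex, so that `Q_F ∘ R_F = id`
and `Q_F` is continuous on the open unit ball. Hoeffding's inequality, conditionally on `x_k`,
shows that the sample ranks `u_k` are uniformly close to `R_F(x_k)`, hence `Q_F(u_k)` to `x_k` when
`‖u_k‖ ≤ r < 1`.

Conversely, since data points accumulate at every `z`, plots against `F₀` that concentrate on the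
diagonal force `R_F(z)` to be a limit of subgradients of `φ_{F₀}` at points tending to `z`, hence a
subgradient of `φ_{F₀}` at `z`. The potentials `φ_F` and `φ_{F₀}` thus share the selection `R_F` of
subgradients and coincide. The potential determines the measure: `‖x‖` is proportional to
`∫ (1 - cos ⟪t, x⟫) / ‖t‖ ^ (d + 1) dt`, so second differences of `φ_F` are Fourier transforms of
the characteristic function of `F` times an explicit weight, which Fourier inversion removes.
-/

namespace SpatialQQ

open NormedSpace (normalize)

section Subgradient

variable {V : Type*} [NormedAddCommGroup V] [InnerProductSpace ℝ V]

/-- `u` is a subgradient of `φ` at `z` in the sense of convex analysis. -/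
def HasSubgradientAt (φ : V → ℝ) (u z : V) : Prop :=
  ∀ y, φ z + inner ℝ u (y - z) ≤ φ y

lemma hasSubgradientAt_iff {φ : V → ℝ} {u z : V} :
    HasSubgradientAt φ u z ↔ ∀ y, φ z - inner ℝ u z ≤ φ y - inner ℝ u y :=
  forall_congr' fun y => by
    rw [inner_sub_right]
    constructor <;> intro h <;> linarith

lemma isClosed_setOf_hasSubgradientAt {φ : V → ℝ} (hφ : Continuous φ) :
    IsClosed {p : V × V | HasSubgradientAt φ p.1 p.2} := by
  simp only [HasSubgradientAt, Set.ofPred_forall]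
  exact isClosed_iInter fun y => isClosed_le (by fun_prop) continuous_const

lemma hasSubgradientAt_of_forall_exists_near {φ : V → ℝ} (hφ : Continuous φ) {u z : V}
    (h : ∀ η > 0, ∃ v q, HasSubgradientAt φ v q ∧ ‖v - u‖ < η ∧ ‖q - z‖ < η) :
    HasSubgradientAt φ u z := by
  have hmem : (u, z) ∈ closure {p : V × V | HasSubgradientAt φ p.1 p.2} :=
    Metric.mem_closure_iff.2 fun η hη => by
      obtain ⟨v, q, hvq, hv, hq⟩ := h η hη
      refine ⟨(v, q), hvq, ?_⟩
      rw [Prod.dist_eq, dist_eq_norm', dist_eq_norm']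
      exact max_lt hv hq
  exact (isClosed_setOf_hasSubgradientAt hφ).closure_subset hmem

/-- Cut `[a, b]` into `n + 1` equal pieces: both increments lie between the same lower and upper
Riemann sums of the selection `R` of subgradients, and the difference of these sums telescopes. -/
lemma sub_sub_sub_le_of_hasSubgradientAt {φ ψ : V → ℝ} {R : V → V}
    (hφ : ∀ z, HasSubgradientAt φ (R z) z) (hψ : ∀ z, HasSubgradientAt ψ (R z) z) (a b : V)
    (n : ℕ) :
    φ b - φ a - (ψ b - ψ a) ≤ inner ℝ (R b - R a) (b - a) * (1 / ((n : ℝ) + 1)) := by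
  let c : V := (1 / ((n : ℝ) + 1)) • (b - a)
  let z : ℕ → V := fun k => a + (k : ℝ) • c
  have hz0 : z 0 = a := by simp [z]
  have hzn : z (n + 1) = b := by
    have hn0 : (n : ℝ) + 1 ≠ 0 := by positivity
    simp only [z, c, smul_smul, Nat.cast_add_one, mul_one_div_cancel hn0, one_smul]
    abel
  have hstep : ∀ k, φ (z (k + 1)) - ψ (z (k + 1)) - (φ (z k) - ψ (z k)) ≤
      inner ℝ (R (z (k + 1))) c - inner ℝ (R (z k)) c := fun k => by
    have hz : z (k + 1) - z k = c := by simp only [z]; push_cast; module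
    have hupper := hφ (z (k + 1)) (z k)
    have hlower := hψ (z k) (z (k + 1))
    rw [← neg_sub, hz, inner_neg_right] at hupper
    rw [hz] at hlower
    linarith
  have hsum := Finset.sum_le_sum fun k (_ : k ∈ Finset.range (n + 1)) => hstep k
  rw [Finset.sum_range_sub fun k => φ (z k) - ψ (z k),
    Finset.sum_range_sub fun k => inner ℝ (R (z k)) c, hz0, hzn, ← inner_sub_left,
    real_inner_smul_right] at hsum
  linarith

lemma sub_eq_sub_of_hasSubgradientAt {φ ψ : V → ℝ} {R : V → V}
    (hφ : ∀ z, HasSubgradientAt φ (R z) z) (hψ : ∀ z, HasSubgradientAt ψ (R z) z) (a b : V) :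
    φ b - φ a = ψ b - ψ a := by
  have hlim := (tendsto_one_div_add_atTop_nhds_zero_nat (𝕜 := ℝ)).const_mul
    (inner ℝ (R b - R a) (b - a))
  rw [mul_zero] at hlim
  apply le_antisymm
  · linarith [ge_of_tendsto' hlim (sub_sub_sub_le_of_hasSubgradientAt hφ hψ a b)]
  · linarith [ge_of_tendsto' hlim (sub_sub_sub_le_of_hasSubgradientAt hψ hφ a b)]

lemma norm_normalize_le (v : V) : ‖normalize v‖ ≤ 1 := by
  rw [NormedSpace.normalize, norm_smul, norm_inv, norm_norm]
  exact inv_mul_le_one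

lemma inner_normalize_self (v : V) : inner ℝ (normalize v) v = ‖v‖ := by
  rcases eq_or_ne v 0 with rfl | hv
  · simp
  · rw [NormedSpace.normalize, real_inner_smul_left, real_inner_self_eq_norm_mul_norm,
      inv_mul_cancel_left₀ (norm_ne_zero_iff.2 hv)]

lemma continuousAt_normalize {v : V} (hv : v ≠ 0) : ContinuousAt (normalize : V → V) v :=
  (continuous_norm.continuousAt.inv₀ (norm_ne_zero_iff.2 hv)).smul continuousAt_id

lemma hasSubgradientAt_norm (v : V) : HasSubgradientAt (fun w => ‖w‖) (normalize v) v := fun w => by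
  have h : inner ℝ (normalize v) w ≤ ‖w‖ :=
    (real_inner_le_norm _ _).trans (mul_le_of_le_one_left (norm_nonneg _) (norm_normalize_le _))
  rw [inner_sub_right, inner_normalize_self]
  linarith

variable [MeasurableSpace V] [BorelSpace V] [SecondCountableTopology V]

lemma measurable_normalize : Measurable (normalize : V → V) :=
  measurable_norm.inv.smul measurable_id

end Subgradient

section Potential

variable {V : Type*} [NormedAddCommGroup V] [MeasurableSpace V]

/-- The potential of `F` for the kernel `‖x - z‖`. Subtracting `‖x‖` makes the integrand bounded, so
that no moment of `F` is needed. -/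
noncomputable def normPotential (F : Measure V) (z : V) : ℝ := ∫ x, (‖x - z‖ - ‖x‖) ∂F

@[simp]
lemma normPotential_zero (F : Measure V) : normPotential F 0 = 0 := by simp [normPotential]

lemma exists_lt_measureReal_closedBall (F : Measure V) [IsProbabilityMeasure F] {p : ℝ}
    (hp : p < 1) : ∃ m : ℕ, p < F.real (Metric.closedBall 0 m) := by
  have hmono : Monotone fun m : ℕ => Metric.closedBall (0 : V) m :=
    fun _ _ h => Metric.closedBall_subset_closedBall (Nat.cast_le.2 h)
  have hlim := (ENNReal.tendsto_toReal (measure_ne_top F _)).comp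
    (tendsto_measure_iUnion_atTop (μ := F) hmono)
  rw [Metric.iUnion_closedBall_nat, measure_univ, ENNReal.toReal_one] at hlim
  exact (hlim.eventually_const_lt hp).exists

variable [BorelSpace V]

lemma integrable_norm_sub_sub_norm (F : Measure V) [IsFiniteMeasure F] (z : V) :
    Integrable (fun x => ‖x - z‖ - ‖x‖) F :=
  Integrable.of_bound (by fun_prop) ‖z‖
    (ae_of_all _ fun x => by simpa using abs_norm_sub_norm_le (x - z) x)

variable (F : Measure V) [IsProbabilityMeasure F]

lemma normPotential_sub_le (a b : V) : normPotential F a - normPotential F b ≤ ‖a - b‖ := by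
  have ha := integrable_norm_sub_sub_norm F a
  have hb := integrable_norm_sub_sub_norm F b
  calc normPotential F a - normPotential F b = ∫ x, (‖x - a‖ - ‖x‖ - (‖x - b‖ - ‖x‖)) ∂F :=
        (integral_sub ha hb).symm
    _ ≤ ∫ _, ‖a - b‖ ∂F := integral_mono (ha.sub hb) (integrable_const _) fun x => by
        have h := norm_sub_norm_le (x - a) (x - b)
        rw [sub_sub_sub_cancel_left, norm_sub_rev b] at h
        linarith
    _ = ‖a - b‖ := by simp

lemma continuous_normPotential : Continuous (normPotential F) :=
  LipschitzWith.continuous (K := 1) <| LipschitzWith.of_dist_le_mul fun a b => by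
    rw [NNReal.coe_one, one_mul, Real.dist_eq, dist_eq_norm, abs_sub_le_iff]
    exact ⟨normPotential_sub_le F a b, norm_sub_rev a b ▸ normPotential_sub_le F b a⟩

lemma exists_mul_norm_sub_le_normPotential {c : ℝ} (hc : c < 1) :
    ∃ B, ∀ z, c * ‖z‖ - B ≤ normPotential F z := by
  obtain ⟨m, hm⟩ := exists_lt_measureReal_closedBall F (p := (1 + c) / 2) (by linarith)
  refine ⟨2 * m, fun z => ?_⟩
  set K := Metric.closedBall (0 : V) m
  have hint : Integrable (fun x => -‖z‖ + K.indicator (fun _ => 2 * ‖z‖ - 2 * m) x) F :=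
    (integrable_const _).add ((integrable_const _).indicator measurableSet_closedBall)
  have hpoint : ∀ x, -‖z‖ + K.indicator (fun _ => 2 * ‖z‖ - 2 * m) x ≤ ‖x - z‖ - ‖x‖ := by
    intro x
    by_cases hx : x ∈ K
    · rw [Set.indicator_of_mem hx]
      have hz := norm_sub_norm_le z x
      rw [norm_sub_rev] at hz
      linarith [mem_closedBall_zero_iff.1 hx]
    · rw [Set.indicator_of_notMem hx]
      linarith [norm_sub_norm_le x z, norm_le_norm_add_norm_sub' x z, norm_sub_rev x z]
  have hle := integral_mono hint (integrable_norm_sub_sub_norm F z) hpoint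
  rw [integral_add (integrable_const _)
      ((integrable_const _).indicator measurableSet_closedBall),
    integral_indicator_const _ measurableSet_closedBall, integral_const, probReal_univ, one_smul,
    smul_eq_mul] at hle
  have hone : F.real K ≤ 1 := measureReal_le_one
  have hz := norm_nonneg z
  change _ ≤ normPotential F z at hle
  nlinarith [m.cast_nonneg (α := ℝ)]

lemma integral_norm_sub_add_norm_sub_sub (a b m : V) :
    ∫ x, (‖x - a‖ + ‖x - b‖ - 2 * ‖x - m‖) ∂F =
      normPotential F a + normPotential F b - 2 * normPotential F m := by
  have hi := integrable_norm_sub_sub_norm F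
  have hab : Integrable (fun x => ‖x - a‖ - ‖x‖ + (‖x - b‖ - ‖x‖)) F := (hi a).add (hi b)
  rw [normPotential, normPotential, normPotential, ← integral_const_mul,
    ← integral_add (hi a) (hi b), ← integral_sub hab ((hi m).const_mul 2)]
  congr 1 with x
  ring

/-- If `a ≠ b`, the inequality `2 ‖x - m‖ ≤ ‖x - a‖ + ‖x - b‖` for the midpoint `m` is strict near
`x = m`, a set of positive mass. -/
lemma two_mul_normPotential_midpoint_lt [NormedSpace ℝ V] [F.IsOpenPosMeasure] {a b : V}
    (hab : a ≠ b) :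
    2 * normPotential F (midpoint ℝ a b) < normPotential F a + normPotential F b := by
  set m := midpoint ℝ a b with hm
  let g : V → ℝ := fun x => ‖x - a‖ + ‖x - b‖ - 2 * ‖x - m‖
  have hg0 : 0 ≤ g := fun x => by
    have hx : x - a + (x - b) = (2 : ℝ) • (x - m) := by
      rw [smul_sub, hm, two_smul ℝ (midpoint ℝ a b), midpoint_add_self, two_smul]
      abel
    have h := norm_add_le (x - a) (x - b)
    rw [hx, norm_smul, Real.norm_two] at h
    exact sub_nonneg.2 h
  have hgm : g m ≠ 0 := by
    have hma : 0 < ‖m - a‖ :=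
      norm_pos_iff.2 (sub_ne_zero.2 fun h => hab ((midpoint_eq_left_iff ℝ).1 h))
    simp only [g, sub_self, norm_zero, mul_zero, sub_zero]
    positivity
  have hgint : Integrable g F := by
    have hi := integrable_norm_sub_sub_norm F
    refine (((hi a).add (hi b)).sub ((hi m).const_mul 2)).congr (ae_of_all _ fun x => ?_)
    simp only [g, Pi.add_apply, Pi.sub_apply]
    ring
  have hpos : 0 < ∫ x, g x ∂F :=
    integral_pos_of_integrable_nonneg_nonzero (by fun_prop) hgint hg0 hgm
  linarith [integral_norm_sub_add_norm_sub_sub F a b m]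

end Potential

section PotentialSubgradient

variable {V : Type*} [NormedAddCommGroup V] [InnerProductSpace ℝ V] [MeasurableSpace V]
  [BorelSpace V] (F : Measure V) [IsProbabilityMeasure F]

lemma exists_norm_le_of_hasSubgradientAt {r : ℝ} (hr : r < 1) :
    ∃ M, ∀ u z, ‖u‖ ≤ r → HasSubgradientAt (normPotential F) u z → ‖z‖ ≤ M := by
  obtain ⟨B, hB⟩ := exists_mul_norm_sub_le_normPotential F (c := (1 + r) / 2) (by linarith)
  refine ⟨2 * B / (1 - r), fun u z hu h => ?_⟩
  have hzero := h 0
  rw [zero_sub, inner_neg_right, normPotential_zero] at hzero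
  have hinner : inner ℝ u z ≤ r * ‖z‖ := (real_inner_le_norm u z).trans (by gcongr)
  rw [le_div_iff₀ (by linarith)]
  linarith [hB z]

lemma exists_hasSubgradientAt_normPotential [FiniteDimensional ℝ V] {u : V} (hu : ‖u‖ < 1) :
    ∃ q, HasSubgradientAt (normPotential F) u q := by
  obtain ⟨c, huc, hc⟩ := exists_between hu
  obtain ⟨B, hB⟩ := exists_mul_norm_sub_le_normPotential F hc
  have hcont : Continuous fun z => normPotential F z - inner ℝ u z :=
    (continuous_normPotential F).sub (by fun_prop)
  have hlim : Tendsto (fun z => normPotential F z - inner ℝ u z) (cocompact V) atTop := by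
    refine tendsto_atTop_mono (fun z => ?_) <| tendsto_atTop_add_const_right _ (-B)
      ((tendsto_norm_cocompact_atTop (E := V)).const_mul_atTop (sub_pos.2 huc))
    linarith [hB z, real_inner_le_norm u z]
  obtain ⟨q, hq⟩ := hcont.exists_forall_le hlim
  exact ⟨q, hasSubgradientAt_iff.2 hq⟩

variable {F} in
lemma eq_of_hasSubgradientAt [F.IsOpenPosMeasure] {u a b : V}
    (ha : HasSubgradientAt (normPotential F) u a) (hb : HasSubgradientAt (normPotential F) u b) :
    a = b := by
  by_contra hab
  have hma := ha (midpoint ℝ a b)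
  have hmb := hb (midpoint ℝ a b)
  rw [midpoint_sub_left] at hma
  rw [midpoint_sub_right, ← neg_sub b a, smul_neg, inner_neg_right] at hmb
  linarith [two_mul_normPotential_midpoint_lt F hab]

/-- If `1 ≤ ‖u‖`, then `u` is also a subgradient at `z + u`, as the potential is `1`-Lipschitz. -/
lemma HasSubgradientAt.norm_lt_one [F.IsOpenPosMeasure] {u z : V}
    (h : HasSubgradientAt (normPotential F) u z) : ‖u‖ < 1 := by
  by_contra! hu
  have hshift : HasSubgradientAt (normPotential F) u (z + u) := fun y => by
    have hlip := normPotential_sub_le F (z + u) z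
    rw [add_sub_cancel_left] at hlip
    rw [← sub_sub, inner_sub_right, real_inner_self_eq_norm_sq]
    nlinarith [h y]
  have hzero : u = 0 := by simpa using eq_of_hasSubgradientAt hshift h
  norm_num [hzero] at hu

end PotentialSubgradient

section RankMap

variable {V : Type*} [NormedAddCommGroup V] [InnerProductSpace ℝ V] [MeasurableSpace V]

/-- The spatial rank function of the distribution `F`, the population version of `spatialRank`. As
there, an atom at `z` does not contribute to the rank of `z`, because `normalize 0 = 0`. -/
noncomputable def rankMap (F : Measure V) (z : V) : V := ∫ x, normalize (z - x) ∂F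

variable [BorelSpace V] [SecondCountableTopology V] (F : Measure V)

lemma measurable_rankMap [SFinite F] : Measurable (rankMap F) :=
  (StronglyMeasurable.integral_prod_right' (f := fun p : V × V => normalize (p.1 - p.2))
    (measurable_normalize.comp (measurable_fst.sub measurable_snd)).stronglyMeasurable).measurable

variable [IsFiniteMeasure F]

lemma integrable_normalize_sub (z : V) : Integrable (fun x => normalize (z - x)) F :=
  Integrable.of_bound
    (measurable_normalize.comp (measurable_const.sub measurable_id)).aestronglyMeasurable 1
    (ae_of_all _ fun _ => norm_normalize_le _)

variable {F} in
lemma continuousAt_rankMap {z : V} (hz : F {z} = 0) : ContinuousAt (rankMap F) z := by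
  refine continuousAt_of_dominated (bound := fun _ => 1)
    (Eventually.of_forall fun w => (integrable_normalize_sub F w).1)
    (Eventually.of_forall fun w => ae_of_all _ fun x => norm_normalize_le _) (integrable_const _) ?_
  filter_upwards [measure_eq_zero_iff_ae_notMem.1 hz] with x hx
  exact (continuousAt_normalize (sub_ne_zero.2 (Ne.symm hx))).comp (f := fun w => w - x)
    (continuous_sub_right x).continuousAt

/-- Where `rankMap F` is discontinuous, `F` has an atom, and the atom itself has positive mass. -/
lemma measure_ball_inter_rankMap_preimage_ball_pos [F.IsOpenPosMeasure] (z : V) {δ η : ℝ}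
    (hδ : 0 < δ) (hη : 0 < η) :
    0 < F (Metric.ball z δ ∩ rankMap F ⁻¹' Metric.ball (rankMap F z) η) := by
  rcases eq_or_ne (F {z}) 0 with hz | hz
  · exact Measure.measure_pos_of_mem_nhds F (inter_mem (Metric.ball_mem_nhds z hδ)
      (continuousAt_rankMap hz (Metric.ball_mem_nhds _ hη)))
  · refine (pos_iff_ne_zero.2 hz).trans_le (measure_mono (Set.singleton_subset_iff.2 ?_))
    exact ⟨Metric.mem_ball_self hδ, Metric.mem_ball_self hη⟩

lemma hasSubgradientAt_rankMap [CompleteSpace V] (z : V) :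
    HasSubgradientAt (normPotential F) (rankMap F z) z := by
  intro y
  have hint := (integrable_normalize_sub F z).const_inner (𝕜 := ℝ) (y - z)
  rw [real_inner_comm, rankMap, ← integral_inner (integrable_normalize_sub F z), normPotential,
    ← integral_add (integrable_norm_sub_sub_norm F z) hint]
  refine integral_mono ((integrable_norm_sub_sub_norm F z).add hint)
    (integrable_norm_sub_sub_norm F y) fun x => ?_
  have h : ‖z - x‖ + inner ℝ (normalize (z - x)) (y - x - (z - x)) ≤ ‖y - x‖ :=
    hasSubgradientAt_norm (z - x) (y - x)
  rw [sub_sub_sub_cancel_right, norm_sub_rev z, norm_sub_rev y, real_inner_comm] at h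
  linarith

end RankMap

section Quantile

variable {d : ℕ} (F : Measure (EuclideanSpace ℝ (Fin d))) [IsProbabilityMeasure F]

lemma integral_Phi_sub (u q : EuclideanSpace ℝ (Fin d)) :
    ∫ x, (Phi u (x - q) - Phi u x) ∂F = normPotential F q - inner ℝ u q := by
  have h : ∀ x, Phi u (x - q) - Phi u x = ‖x - q‖ - ‖x‖ - inner ℝ u q := fun x => by
    simp only [Phi, inner_sub_right]
    ring
  simp only [h]
  rw [integral_sub (integrable_norm_sub_sub_norm F q) (integrable_const _)]
  simp [normPotential]

variable {F}

lemma isSpatialQuantile_iff {u q : EuclideanSpace ℝ (Fin d)} :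
    IsSpatialQuantile F u q ↔ HasSubgradientAt (normPotential F) u q := by
  simp [IsSpatialQuantile, isMinOn_iff, integral_Phi_sub, hasSubgradientAt_iff]

lemma hasSubgradientAt_spatialQuantile {u : EuclideanSpace ℝ (Fin d)} (hu : ‖u‖ < 1) :
    HasSubgradientAt (normPotential F) u (spatialQuantile F u) :=
  isSpatialQuantile_iff.1 <| Classical.epsilon_spec <|
    (exists_hasSubgradientAt_normPotential F hu).imp fun _ => isSpatialQuantile_iff.2

variable [F.IsOpenPosMeasure]

lemma HasSubgradientAt.spatialQuantile_eq {u z : EuclideanSpace ℝ (Fin d)}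
    (h : HasSubgradientAt (normPotential F) u z) : spatialQuantile F u = z :=
  eq_of_hasSubgradientAt (hasSubgradientAt_spatialQuantile (h.norm_lt_one F)) h

lemma spatialQuantile_rankMap (z : EuclideanSpace ℝ (Fin d)) :
    spatialQuantile F (rankMap F z) = z :=
  (hasSubgradientAt_rankMap F z).spatialQuantile_eq

/-- Limit points of quantiles are quantiles, by closedness of the subdifferential. -/
lemma continuousOn_spatialQuantile :
    ContinuousOn (spatialQuantile F) (Metric.ball 0 1) := by
  refine Metric.isOpen_ball.continuousOn_iff.2 fun u hu => ?_
  obtain ⟨r, hur, hr⟩ := exists_between (mem_ball_zero_iff.1 hu)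
  obtain ⟨M, hM⟩ := exists_norm_le_of_hasSubgradientAt F hr
  have hnear : ∀ᶠ v in 𝓝 u, ‖v‖ < r := continuous_norm.continuousAt.eventually_lt_const hur
  refine (isCompact_closedBall 0 M).tendsto_nhds_of_unique_mapClusterPt ?_ fun q _ hq => ?_
  · filter_upwards [hnear] with v hv
    exact mem_closedBall_zero_iff.2
      (hM v _ hv.le (hasSubgradientAt_spatialQuantile (hv.trans hr)))
  · obtain ⟨U, hUu, hUq⟩ := mapClusterPt_iff_ultrafilter.1 hq
    have hlim : Tendsto (fun v => (v, spatialQuantile F v)) U (𝓝 (u, q)) :=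
      (tendsto_id'.2 hUu).prodMk_nhds hUq
    have hmem : (u, q) ∈ {p : _ × _ | HasSubgradientAt (normPotential F) p.1 p.2} := by
      refine (isClosed_setOf_hasSubgradientAt (continuous_normPotential F)).mem_of_tendsto hlim ?_
      filter_upwards [hnear.filter_mono hUu] with v hv
      exact hasSubgradientAt_spatialQuantile (hv.trans hr)
    exact (HasSubgradientAt.spatialQuantile_eq hmem).symm

end Quantile

section Fourier

open scoped FourierTransform

lemma integrableOn_Ioi_min_one_sq_div_sq :
    IntegrableOn (fun y : ℝ => min 1 (y ^ 2) / y ^ 2) (Set.Ioi 0) := by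
  rw [← Set.Ioc_union_Ioi_eq_Ioi zero_le_one]
  refine IntegrableOn.union ?_ ?_
  · refine IntegrableOn.congr_fun (f := fun _ => (1 : ℝ)) (by simp) (fun y hy => ?_)
      measurableSet_Ioc
    simp only [min_eq_right (pow_le_one₀ hy.1.le hy.2), div_self (pow_ne_zero 2 hy.1.ne')]
  · refine (integrableOn_Ioi_rpow_of_lt (a := -2) (by norm_num) one_pos).congr_fun (fun y hy => ?_)
      measurableSet_Ioi
    have hy1 : 1 ≤ y := (Set.mem_Ioi.1 hy).le
    simp only [min_eq_left (one_le_pow₀ hy1), Real.rpow_neg (zero_le_one.trans hy1),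
      Real.rpow_two, one_div]

variable {V : Type*} [NormedAddCommGroup V] [InnerProductSpace ℝ V]

/-- The weight `(1 - cos ⟪t, x⟫) / ‖t‖ ^ (dim V + 1)`, whose integral over `t` is proportional to
`‖x‖`. It turns the potential of a measure into an integral of its characteristic function. -/
noncomputable def cosWeight (x t : V) : ℝ :=
  (1 - Real.cos (inner ℝ t x)) / ‖t‖ ^ (Module.finrank ℝ V + 1)

lemma cosWeight_nonneg (x t : V) : 0 ≤ cosWeight x t :=
  div_nonneg (sub_nonneg.2 (Real.cos_le_one _)) (by positivity)

lemma cosWeight_neg_right (x t : V) : cosWeight x (-t) = cosWeight x t := by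
  simp [cosWeight]

lemma cosWeight_smul_left {a : ℝ} (ha : 0 < a) (x t : V) :
    cosWeight (a • x) t = a ^ (Module.finrank ℝ V + 1) * cosWeight x (a • t) := by
  simp only [cosWeight, real_inner_smul_left, real_inner_smul_right, norm_smul,
    Real.norm_of_nonneg ha.le, mul_pow]
  field_simp

lemma cosWeight_add_add_cosWeight_sub (x h t : V) :
    cosWeight (x + h) t + cosWeight (x - h) t - 2 * cosWeight x t =
      2 * (Real.cos (inner ℝ x t) * cosWeight h t) := by
  simp only [cosWeight, inner_add_right, inner_sub_right, Real.cos_add, Real.cos_sub,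
    real_inner_comm t x]
  ring

lemma continuousAt_cosWeight (x : V) {t : V} (ht : t ≠ 0) : ContinuousAt (cosWeight x) t := by
  unfold cosWeight
  exact ContinuousAt.div (by fun_prop) (by fun_prop) (pow_ne_zero _ (norm_ne_zero_iff.2 ht))

lemma exists_cosWeight_ne_zero {t : V} (ht : t ≠ 0) : ∃ h : V, cosWeight h t ≠ 0 := by
  have hn := norm_ne_zero_iff.2 ht
  refine ⟨(Real.pi / ‖t‖ ^ 2) • t, ?_⟩
  rw [cosWeight, real_inner_smul_right, real_inner_self_eq_norm_sq,
    div_mul_cancel₀ _ (pow_ne_zero 2 hn), Real.cos_pi]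
  positivity

lemma one_sub_cos_inner_le (x t : V) :
    1 - Real.cos (inner ℝ t x) ≤ (2 + ‖x‖ ^ 2) * min 1 (‖t‖ ^ 2) := by
  have hlarge : 1 - Real.cos (inner ℝ t x) ≤ 2 := by linarith [Real.neg_one_le_cos (inner ℝ t x)]
  have hsmall : 1 - Real.cos (inner ℝ t x) ≤ ‖x‖ ^ 2 * ‖t‖ ^ 2 := by
    have hsq : (inner ℝ t x) ^ 2 ≤ (‖t‖ * ‖x‖) ^ 2 :=
      sq_le_sq.2 ((abs_real_inner_le_norm t x).trans (le_abs_self _))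
    rw [mul_pow] at hsq
    linarith [Real.one_sub_sq_div_two_le_cos (x := inner ℝ t x),
      mul_nonneg (sq_nonneg ‖t‖) (sq_nonneg ‖x‖)]
  rw [mul_min_of_nonneg _ _ (by positivity), le_min_iff]
  constructor <;> nlinarith [sq_nonneg ‖x‖, sq_nonneg ‖t‖]

variable [MeasurableSpace V] [BorelSpace V] [FiniteDimensional ℝ V]

lemma measurable_cosWeight (x : V) : Measurable (cosWeight x) := by
  unfold cosWeight
  fun_prop

lemma integrable_min_one_norm_sq_div [Nontrivial V] :
    Integrable (fun t : V => min 1 (‖t‖ ^ 2) / ‖t‖ ^ (Module.finrank ℝ V + 1)) := by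
  obtain ⟨m, hm⟩ := Nat.exists_eq_add_one.2 (Module.finrank_pos (R := ℝ) (M := V))
  rw [integrable_fun_norm_addHaar volume
    (f := fun y : ℝ => min 1 (y ^ 2) / y ^ (Module.finrank ℝ V + 1))]
  refine integrableOn_Ioi_min_one_sq_div_sq.congr_fun (fun y hy => ?_) measurableSet_Ioi
  have hy0 : y ≠ 0 := (Set.mem_Ioi.1 hy).ne'
  simp only [hm, Nat.add_sub_cancel, smul_eq_mul]
  field_simp
  ring

lemma integrable_cosWeight [Nontrivial V] (x : V) : Integrable (cosWeight x) := by
  refine (integrable_min_one_norm_sq_div.const_mul (2 + ‖x‖ ^ 2)).mono'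
    (measurable_cosWeight x).aestronglyMeasurable (ae_of_all _ fun t => ?_)
  rw [Real.norm_of_nonneg (cosWeight_nonneg x t), cosWeight, ← mul_div_assoc]
  gcongr
  exact one_sub_cos_inner_le x t

lemma integral_cosWeight_smul {a : ℝ} (ha : 0 < a) (x : V) :
    ∫ t, cosWeight (a • x) t = a * ∫ t, cosWeight x t := by
  simp_rw [cosWeight_smul_left ha]
  rw [integral_const_mul, Measure.integral_comp_smul, abs_of_pos (by positivity), smul_eq_mul]
  field_simp
  ring

lemma integral_cosWeight_eq_of_norm_eq {x y : V} (h : ‖x‖ = ‖y‖) :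
    ∫ t, cosWeight x t = ∫ t, cosWeight y t := by
  let g := (ℝ ∙ (x - y))ᗮ.reflection
  have hg : g x = y := Submodule.reflection_sub h
  rw [← g.measurePreserving.integral_comp g.toHomeomorph.measurableEmbedding (cosWeight y)]
  congr 1 with t
  simp only [cosWeight]
  rw [← hg, LinearIsometryEquiv.inner_map_map, LinearIsometryEquiv.norm_map]

lemma exists_integral_cosWeight_eq [Nontrivial V] :
    ∃ c : ℝ, ∀ x : V, ∫ t, cosWeight x t = c * ‖x‖ := by
  obtain ⟨e, he⟩ := exists_norm_eq V (zero_le_one (α := ℝ))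
  refine ⟨∫ t, cosWeight e t, fun x => ?_⟩
  rcases eq_or_ne x 0 with rfl | hx
  · simp [cosWeight]
  · rw [mul_comm, ← integral_cosWeight_smul (norm_pos_iff.2 hx) e]
    exact integral_cosWeight_eq_of_norm_eq (by simp [norm_smul, he])

lemma integral_cos_mul_cosWeight [Nontrivial V] {c : ℝ}
    (hc : ∀ x : V, ∫ t, cosWeight x t = c * ‖x‖) (x h : V) :
    ∫ t, Real.cos (inner ℝ x t) * cosWeight h t =
      c / 2 * (‖x + h‖ + ‖x - h‖ - 2 * ‖x‖) := by
  have hw := integrable_cosWeight (V := V)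
  have hadd : Integrable fun t => cosWeight (x + h) t + cosWeight (x - h) t :=
    (hw _).add (hw _)
  have hsecond : 2 * ∫ t, Real.cos (inner ℝ x t) * cosWeight h t =
      c * ‖x + h‖ + c * ‖x - h‖ - 2 * (c * ‖x‖) := by
    simp_rw [← integral_const_mul, ← cosWeight_add_add_cosWeight_sub]
    rw [integral_sub hadd ((hw _).const_mul 2), integral_add (hw _) (hw _), integral_const_mul,
      hc, hc, hc]
  linarith

lemma integrable_exp_mul_ofReal {w : V → ℝ} (hw : Integrable w) (x : V) :
    Integrable fun t => Complex.exp ((inner ℝ x t : ℝ) * Complex.I) * (w t : ℂ) :=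
  hw.ofReal.bdd_mul (c := 1) (by fun_prop)
    (ae_of_all _ fun t => (Complex.norm_exp_ofReal_mul_I _).le)

lemma integral_exp_mul_ofReal_of_even {w : V → ℝ} (hw : Integrable w)
    (heven : ∀ t, w (-t) = w t) (x : V) :
    ∫ t, Complex.exp ((inner ℝ x t : ℝ) * Complex.I) * (w t : ℂ) =
      ((∫ t, Real.cos (inner ℝ x t) * w t : ℝ) : ℂ) := by
  have hint := integrable_exp_mul_ofReal hw x
  apply Complex.ext
  · rw [Complex.ofReal_re, ← RCLike.re_eq_complex_re, ← integral_re hint]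
    simp only [RCLike.re_eq_complex_re, Complex.re_mul_ofReal, Complex.exp_ofReal_mul_I_re]
  · have hodd := integral_neg_eq_self (fun t => Real.sin (inner ℝ x t) * w t) volume
    simp only [inner_neg_right, Real.sin_neg, heven, neg_mul, integral_neg] at hodd
    rw [Complex.ofReal_im, ← RCLike.im_eq_complex_im, ← integral_im hint]
    simp only [RCLike.im_eq_complex_im, Complex.im_mul_ofReal, Complex.exp_ofReal_mul_I_im]
    linarith

/-- Fubini: the transform of `cosWeight h` at `x - y` is a multiple of the second difference of the
norm at `x - y` in the direction `h`, whose `F`-average is that of the potential at `y`. -/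
lemma fourier_charFun_mul_cosWeight [Nontrivial V] {c : ℝ}
    (hc : ∀ x : V, ∫ t, cosWeight x t = c * ‖x‖) (F : Measure V) [IsProbabilityMeasure F]
    (h w : V) :
    𝓕 (fun t => charFun F t * (cosWeight h t : ℂ)) w =
      ((c / 2 * (normPotential F ((2 * Real.pi) • w - h) + normPotential F ((2 * Real.pi) • w + h) -
        2 * normPotential F ((2 * Real.pi) • w)) : ℝ) : ℂ) := by
  set y := (2 * Real.pi) • w with hy
  have hint : Integrable (Function.uncurry fun x t : V =>
      Complex.exp ((inner ℝ (x - y) t : ℝ) * Complex.I) * (cosWeight h t : ℂ))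
      (F.prod volume) := by
    have hw : Integrable fun t => (cosWeight h t : ℂ) := (integrable_cosWeight h).ofReal
    exact (hw.comp_snd F).bdd_mul (c := 1) (Continuous.aestronglyMeasurable (by fun_prop))
      (ae_of_all _ fun p => (Complex.norm_exp_ofReal_mul_I _).le)
  have hinner : ∀ x, ∫ t, Complex.exp ((inner ℝ (x - y) t : ℝ) * Complex.I) * (cosWeight h t : ℂ) =
      ((c / 2 * (‖x - (y - h)‖ + ‖x - (y + h)‖ - 2 * ‖x - y‖) : ℝ) : ℂ) := fun x => by
    rw [integral_exp_mul_ofReal_of_even (integrable_cosWeight h) (cosWeight_neg_right h),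
      integral_cos_mul_cosWeight hc, sub_add, sub_sub]
  have hswap := integral_integral_swap hint
  simp only [hinner] at hswap
  rw [integral_complex_ofReal, integral_const_mul, integral_norm_sub_add_norm_sub_sub] at hswap
  rw [hswap, Real.fourier_eq']
  congr 1 with t
  rw [charFun_apply, smul_eq_mul, ← mul_assoc, ← integral_const_mul, ← integral_mul_const]
  congr 1 with x
  rw [← Complex.exp_add, inner_sub_left, hy, real_inner_smul_left, real_inner_comm w]
  congr 2
  push_cast
  ring

lemma eq_of_fourier_eq {E : Type*} [NormedAddCommGroup E] [NormedSpace ℂ E] [CompleteSpace E]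
    {f g : V → E} (hf : Integrable f) (hg : Integrable g) (hfg : 𝓕 f = 𝓕 g) {t : V}
    (hft : ContinuousAt f t) (hgt : ContinuousAt g t) : f t = g t := by
  have hzero : 𝓕 (f - g) = 0 := by
    ext w
    have h := congrFun hfg w
    simp only [Real.fourier_eq, Pi.sub_apply, smul_sub, Pi.zero_apply] at h ⊢
    rw [integral_sub ((Real.fourierIntegral_convergent_iff w).2 hf)
      ((Real.fourierIntegral_convergent_iff w).2 hg), h, sub_self]
  have hinv := (hf.sub hg).fourierInv_fourier_eq (by rw [hzero]; exact integrable_zero _ _ _)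
    (hft.sub hgt)
  rw [hzero, Real.fourierInv_eq'] at hinv
  simpa [sub_eq_zero, eq_comm] using hinv

theorem eq_of_normPotential_eq {F G : Measure V} [IsProbabilityMeasure F] [IsProbabilityMeasure G]
    (hFG : normPotential F = normPotential G) : F = G := by
  refine Measure.ext_of_charFun (funext fun t => ?_)
  rcases eq_or_ne t 0 with rfl | ht
  · simp
  have : Nontrivial V := nontrivial_of_ne t 0 ht
  obtain ⟨c, hc⟩ := exists_integral_cosWeight_eq (V := V)
  obtain ⟨h, hh⟩ := exists_cosWeight_ne_zero ht
  have hint : ∀ (H : Measure V) [IsProbabilityMeasure H],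
      Integrable fun s => charFun H s * (cosWeight h s : ℂ) := fun H _ =>
    (integrable_cosWeight h).ofReal.bdd_mul (c := 1) (by fun_prop)
      (ae_of_all _ fun s => norm_charFun_le_one s)
  have hcont : ∀ (H : Measure V) [IsProbabilityMeasure H],
      ContinuousAt (fun s => charFun H s * (cosWeight h s : ℂ)) t := fun H _ =>
    continuous_charFun.continuousAt.mul
      (Complex.continuous_ofReal.continuousAt.comp (continuousAt_cosWeight h ht))
  refine mul_right_cancel₀ (Complex.ofReal_ne_zero.2 hh)
    (eq_of_fourier_eq (hint F) (hint G) (funext fun w => ?_) (hcont F) (hcont G))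
  rw [fourier_charFun_mul_cosWeight hc, fourier_charFun_mul_cosWeight hc, hFG]

end Fourier

section Probability

variable {Ω : Type*} [MeasurableSpace Ω] {P : Measure Ω}

lemma eventually_exists_mem_notMem {C : Set Ω} {D E : ℕ → Set Ω} (hC : P C < 1)
    (hD : Tendsto (fun n => P (D n)) atTop (𝓝 0)) (hE : Tendsto (fun n => P (E n)) atTop (𝓝 1)) :
    ∀ᶠ n in atTop, ∃ ω ∈ E n, ω ∉ D n ∧ ω ∉ C := by
  have hDC : Tendsto (fun n => P (D n) + P C) atTop (𝓝 (P C)) := by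
    simpa using hD.add_const (P C)
  filter_upwards [hDC.eventually_lt hE hC] with n hn
  by_contra! hcover
  refine hn.not_ge ((measure_mono fun ω hω => ?_).trans (measure_union_le (D n) C))
  exact or_iff_not_imp_left.2 (hcover ω hω)

variable [IsProbabilityMeasure P]

lemma measure_prodMk_mem_le_of_indepFun {α β : Type*} [MeasurableSpace α] [MeasurableSpace β]
    {Y : Ω → α} {Z : Ω → β} (hY : AEMeasurable Y P) (hZ : AEMeasurable Z P) (hYZ : IndepFun Y Z P)
    {A : Set (α × β)} (hA : MeasurableSet A) {p : ENNReal}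
    (hp : ∀ y, P {ω | (y, Z ω) ∈ A} ≤ p) : P {ω | (Y ω, Z ω) ∈ A} ≤ p := by
  have : IsProbabilityMeasure (P.map Y) := Measure.isProbabilityMeasure_map hY
  calc P {ω | (Y ω, Z ω) ∈ A} = P.map (fun ω => (Y ω, Z ω)) A :=
        (Measure.map_apply_of_aemeasurable (hY.prodMk hZ) hA).symm
    _ = ∫⁻ y, P.map Z (Prod.mk y ⁻¹' A) ∂P.map Y := by
        rw [(indepFun_iff_map_prod_eq_prod_map_map hY hZ).1 hYZ, Measure.prod_apply hA]
    _ ≤ ∫⁻ _, p ∂P.map Y := lintegral_mono fun y => by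
        rw [Measure.map_apply_of_aemeasurable hZ (measurable_prodMk_left hA)]
        exact hp y
    _ = p := by simp

lemma tendsto_measure_one_of_compl_subset {D E : ℕ → Set Ω}
    (hD : Tendsto (fun n => P (D n)) atTop (𝓝 0)) (hDE : ∀ n, (D n)ᶜ ⊆ E n) :
    Tendsto (fun n => P (E n)) atTop (𝓝 1) := by
  have hlow := ENNReal.Tendsto.sub (tendsto_const_nhds (x := (1 : ENNReal))) hD
    (Or.inl ENNReal.one_ne_top)
  rw [tsub_zero] at hlow
  refine tendsto_of_tendsto_of_tendsto_of_le_of_le hlow tendsto_const_nhds (fun n => ?_)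
    fun n => prob_le_one
  rw [tsub_le_iff_left, ← measure_univ (μ := P), ← Set.union_compl_self (D n)]
  exact (measure_union_le _ _).trans (by gcongr; exact hDE n)

end Probability

section Concentration

variable {V : Type*} [NormedAddCommGroup V] [InnerProductSpace ℝ V] [MeasurableSpace V]

/-- The contribution of a data point `x` to the deviation, in the direction `w`, of the empirical
spatial rank of `z` from its population value. -/
noncomputable def rankDeviation (F : Measure V) (w z x : V) : ℝ :=
  inner ℝ w (normalize (z - x) - rankMap F z)

lemma rankDeviation_self_le (F : Measure V) [IsProbabilityMeasure F] {w : V} (hw : ‖w‖ ≤ 1)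
    (z : V) : rankDeviation F w z z ≤ 1 := by
  have hR : ‖rankMap F z‖ ≤ 1 := by
    simpa [rankMap] using norm_integral_le_of_norm_le_const (μ := F)
      (ae_of_all _ fun x => norm_normalize_le (z - x))
  rw [rankDeviation, sub_self, NormedSpace.normalize_zero_eq_zero, zero_sub]
  exact (real_inner_le_norm _ _).trans (mul_le_one₀ hw (norm_nonneg _) (by rwa [norm_neg]))

variable [BorelSpace V] [FiniteDimensional ℝ V] {F : Measure V} [IsProbabilityMeasure F]
  {Ω : Type*} [MeasurableSpace Ω] {P : Measure Ω} [IsProbabilityMeasure P]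

variable (F) in
lemma measurable_rankDeviation (w : V) :
    Measurable fun p : V × V => rankDeviation F w p.1 p.2 :=
  ((measurable_normalize.comp (measurable_fst.sub measurable_snd)).sub
    ((measurable_rankMap F).comp measurable_fst)).const_inner

lemma hasSubgaussianMGF_rankDeviation {Y : Ω → V} (hY : HasLaw Y F P) {w : V} (hw : ‖w‖ ≤ 1)
    (z : V) : HasSubgaussianMGF (fun ω => rankDeviation F w z (Y ω)) 1 P := by
  let g : V → ℝ := fun x => inner ℝ w (normalize (z - x))
  have hg : Measurable g :=
    (measurable_normalize.comp (measurable_const.sub measurable_id)).const_inner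
  have hbound : ∀ x, g x ∈ Set.Icc (-1 : ℝ) 1 := fun x =>
    abs_le.1 ((abs_real_inner_le_norm _ _).trans
      (mul_le_one₀ hw (norm_nonneg _) (norm_normalize_le _)))
  have hmean : ∫ ω, g (Y ω) ∂P = inner ℝ w (rankMap F z) := by
    rw [rankMap, ← integral_inner (integrable_normalize_sub F z), ← hY.map_eq,
      integral_map hY.aemeasurable hg.aestronglyMeasurable]
  have hsub := hasSubgaussianMGF_of_mem_Icc (μ := P) (hg.comp_aemeasurable hY.aemeasurable)
    (ae_of_all _ fun ω => hbound (Y ω))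
  have hvar : (‖(1 : ℝ) - (-1)‖₊ / 2) ^ 2 = 1 := by
    ext
    norm_num
  simp only [hvar, Function.comp_apply, hmean] at hsub
  simpa only [rankDeviation, inner_sub_right] using hsub

variable {ι : Type*} {X : ι → Ω → V}

lemma measure_le_sum_rankDeviation_le (hlaw : ∀ j, HasLaw (X j) F P) (hindep : iIndepFun X P)
    {w : V} (hw : ‖w‖ ≤ 1) (z : V) (S : Finset ι) {t : ℝ} (ht : 0 ≤ t) :
    P {ω | t ≤ ∑ j ∈ S, rankDeviation F w z (X j ω)} ≤
      ENNReal.ofReal (Real.exp (-t ^ 2 / (2 * S.card))) := by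
  have hind : iIndepFun (fun j ω => rankDeviation F w z (X j ω)) P :=
    hindep.comp (fun _ => rankDeviation F w z) fun _ =>
      (measurable_rankDeviation F w).comp measurable_prodMk_left
  refine (ENNReal.le_ofReal_iff_toReal_le (measure_ne_top _ _) (Real.exp_pos _).le).2 ?_
  simpa [Measure.real] using HasSubgaussianMGF.measure_sum_ge_le_of_iIndepFun hind
    (fun j _ => hasSubgaussianMGF_rankDeviation (hlaw j) hw z) ht

lemma measure_le_sum_rankDeviation_le_of_notMem (hlaw : ∀ j, HasLaw (X j) F P)
    (hindep : iIndepFun X P) {w : V} (hw : ‖w‖ ≤ 1) {k : ι} {S : Finset ι} (hk : k ∉ S) {t : ℝ}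
    (ht : 0 ≤ t) :
    P {ω | t ≤ ∑ j ∈ S, rankDeviation F w (X k ω) (X j ω)} ≤
      ENNReal.ofReal (Real.exp (-t ^ 2 / (2 * S.card))) := by
  have hX : ∀ j, AEMeasurable (X j) P := fun j => (hlaw j).aemeasurable
  let Y : Ω → S → V := fun ω j => X j ω
  have hY : AEMeasurable Y P := aemeasurable_pi_lambda _ fun j => hX j
  have hXY : IndepFun (X k) Y P :=
    (hindep.indepFun_finset₀ {k} S (Finset.disjoint_singleton_left.2 hk) hX).comp
      (φ := fun f : ({k} : Finset ι) → V => f ⟨k, Finset.mem_singleton_self k⟩)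
      (measurable_pi_apply _) measurable_id
  let A : Set (V × (S → V)) := {p | t ≤ ∑ j, rankDeviation F w p.1 (p.2 j)}
  have hA : MeasurableSet A := measurableSet_le measurable_const <|
    Finset.measurable_sum _ fun j _ => (measurable_rankDeviation F w).comp
      (measurable_fst.prodMk ((measurable_pi_apply j).comp measurable_snd))
  have hmem : ∀ z ω, (z, Y ω) ∈ A ↔ t ≤ ∑ j ∈ S, rankDeviation F w z (X j ω) := fun z ω => by
    simp only [A, Y, Set.mem_ofPred_eq, Finset.sum_coe_sort S fun j => rankDeviation F w z (X j ω)]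
  simp only [← hmem]
  refine measure_prodMk_mem_le_of_indepFun (hX k) hY hXY hA fun z => ?_
  simp only [hmem]
  exact measure_le_sum_rankDeviation_le hlaw hindep hw z S ht

end Concentration

section EmpiricalRank

lemma exists_finset_half_norm_le_inner (V : Type*) [NormedAddCommGroup V] [InnerProductSpace ℝ V]
    [FiniteDimensional ℝ V] :
    ∃ T : Finset V, (∀ w ∈ T, ‖w‖ ≤ 1) ∧ ∀ v, ∃ w ∈ T, ‖v‖ / 2 ≤ inner ℝ w v := by
  obtain ⟨T, hT, hfin, hcover⟩ :=
    (isCompact_closedBall (0 : V) 1).finite_cover_balls (e := 1 / 2) (by norm_num)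
  refine ⟨hfin.toFinset, fun w hw => mem_closedBall_zero_iff.1 (hT (hfin.mem_toFinset.1 hw)),
    fun v => ?_⟩
  obtain ⟨w, hw, hvw⟩ := Set.mem_iUnion₂.1
    (hcover (mem_closedBall_zero_iff.2 (norm_normalize_le v)))
  refine ⟨w, hfin.mem_toFinset.2 hw, ?_⟩
  have hdiff : inner ℝ (normalize v - w) v ≤ 1 / 2 * ‖v‖ :=
    (real_inner_le_norm _ _).trans (by gcongr; exact (mem_ball_iff_norm.1 hvw).le)
  rw [inner_sub_left, inner_normalize_self] at hdiff
  linarith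

variable {d : ℕ}

lemma spatialRank_eq_sum_normalize {n : ℕ} (x : Fin n → EuclideanSpace ℝ (Fin d))
    (z : EuclideanSpace ℝ (Fin d)) :
    spatialRank x z = (n : ℝ)⁻¹ • ∑ i, normalize (z - x i) := by
  rw [spatialRank, Finset.sum_filter_of_ne]
  · rfl
  · rintro i - hi hz
    simp [hz] at hi

variable (F : Measure (EuclideanSpace ℝ (Fin d)))

lemma inner_spatialRank_sub_rankMap {n : ℕ} (hn : n ≠ 0) (x : ℕ → EuclideanSpace ℝ (Fin d))
    (w z : EuclideanSpace ℝ (Fin d)) :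
    n * inner ℝ w (spatialRank (fun j : Fin n => x j) z - rankMap F z) =
      ∑ j ∈ Finset.range n, rankDeviation F w z (x j) := by
  rw [spatialRank_eq_sum_normalize, Fin.sum_univ_eq_sum_range fun j => normalize (z - x j)]
  simp only [rankDeviation, inner_sub_right, real_inner_smul_right, inner_sum,
    Finset.sum_sub_distrib, Finset.sum_const, Finset.card_range, nsmul_eq_mul]
  field_simp

/-- The `k`-th summand is the only one that is not a deviation at a point independent of `X k`. -/
lemma le_sum_erase_rankDeviation [IsProbabilityMeasure F] {n : ℕ} (k : Fin n)
    (x : ℕ → EuclideanSpace ℝ (Fin d)) {w : EuclideanSpace ℝ (Fin d)} (hw : ‖w‖ ≤ 1) {η : ℝ}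
    (h : η ≤ inner ℝ w (spatialRank (fun j : Fin n => x j) (x k) - rankMap F (x k))) :
    n * η - 1 ≤ ∑ j ∈ (Finset.range n).erase k, rankDeviation F w (x k) (x j) := by
  have hsum := Finset.add_sum_erase (Finset.range n)
    (fun j => rankDeviation F w (x k) (x j)) (Finset.mem_range.2 k.2)
  rw [← inner_spatialRank_sub_rankMap F k.pos.ne'] at hsum
  have hη := mul_le_mul_of_nonneg_left h (Nat.cast_nonneg n)
  linarith [rankDeviation_self_le F hw (x k)]

variable {F} [IsProbabilityMeasure F] {Ω : Type*} [MeasurableSpace Ω] {P : Measure Ω}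
  [IsProbabilityMeasure P] {X : ℕ → Ω → EuclideanSpace ℝ (Fin d)}

lemma measure_le_inner_spatialRank_sub_rankMap_le (hlaw : ∀ j, HasLaw (X j) F P)
    (hindep : iIndepFun X P) {n : ℕ} (k : Fin n) {w : EuclideanSpace ℝ (Fin d)} (hw : ‖w‖ ≤ 1)
    {η : ℝ} (hn2 : 2 ≤ n) (hn : 2 ≤ n * η) :
    P {ω | η ≤ inner ℝ w (spatialRank (fun j : Fin n => X j ω) (X k ω) - rankMap F (X k ω))} ≤
      ENNReal.ofReal (Real.exp (-(η ^ 2 / 8)) ^ n) := by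
  have hn0 : (2 : ℝ) ≤ n := by exact_mod_cast hn2
  calc _ ≤ P {ω | n * η / 2 ≤
          ∑ j ∈ (Finset.range n).erase k, rankDeviation F w (X k ω) (X j ω)} :=
        measure_mono fun ω hω => by
          have hsum := le_sum_erase_rankDeviation F k (fun j => X j ω) hw hω
          exact Set.mem_ofPred_eq ▸ (by linarith)
    _ ≤ ENNReal.ofReal (Real.exp (-(n * η / 2) ^ 2 / (2 * ((Finset.range n).erase k).card))) :=
        measure_le_sum_rankDeviation_le_of_notMem hlaw hindep hw (Finset.notMem_erase _ _)
          (by linarith)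
    _ ≤ ENNReal.ofReal (Real.exp (-(η ^ 2 / 8)) ^ n) := by
        refine ENNReal.ofReal_le_ofReal ?_
        rw [Finset.card_erase_of_mem (Finset.mem_range.2 k.2), Finset.card_range,
          ← Real.exp_nat_mul, Nat.cast_sub (by omega), Nat.cast_one, Real.exp_le_exp,
          div_le_iff₀ (by linarith)]
        nlinarith [mul_nonneg (sq_nonneg η) (Nat.cast_nonneg (α := ℝ) n)]

theorem tendsto_measure_exists_le_norm_spatialRank_sub_rankMap (hlaw : ∀ j, HasLaw (X j) F P)
    (hindep : iIndepFun X P) {δ : ℝ} (hδ : 0 < δ) :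
    Tendsto (fun n : ℕ => P {ω | ∃ k : Fin n,
      δ ≤ ‖spatialRank (fun j : Fin n => X j ω) (X k ω) - rankMap F (X k ω)‖}) atTop (𝓝 0) := by
  obtain ⟨T, hT, hnorm⟩ := exists_finset_half_norm_le_inner (EuclideanSpace ℝ (Fin d))
  set ρ := Real.exp (-((δ / 2) ^ 2 / 8))
  have hlim : Tendsto (fun n : ℕ => ENNReal.ofReal (T.card * (n * ρ ^ n))) atTop (𝓝 0) := by
    have hρ : ρ < 1 := Real.exp_lt_one_iff.2 (neg_lt_zero.2 (by positivity))
    have hgeom := (tendsto_self_mul_const_pow_of_lt_one (Real.exp_pos _).le hρ).const_mul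
      (T.card : ℝ)
    rw [mul_zero] at hgeom
    exact ENNReal.ofReal_zero ▸ ENNReal.tendsto_ofReal hgeom
  have hbig : ∀ᶠ n : ℕ in atTop, 2 ≤ (n : ℝ) * (δ / 2) :=
    (tendsto_natCast_atTop_atTop.atTop_mul_const (half_pos hδ)).eventually_ge_atTop 2
  refine tendsto_of_tendsto_of_tendsto_of_le_of_le' tendsto_const_nhds hlim
    (Eventually.of_forall fun _ => zero_le) ?_
  filter_upwards [hbig, eventually_ge_atTop 2] with n hn hn2
  let A (p : Fin n × T) : Set Ω := {ω | δ / 2 ≤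
    inner ℝ (p.2 : EuclideanSpace ℝ (Fin d))
      (spatialRank (fun j : Fin n => X j ω) (X p.1 ω) - rankMap F (X p.1 ω))}
  calc _ ≤ P (⋃ p, A p) := by
        refine measure_mono ?_
        rintro ω ⟨k, hk⟩
        obtain ⟨w, hw, hkw⟩ :=
          hnorm (spatialRank (fun j : Fin n => X j ω) (X k ω) - rankMap F (X k ω))
        exact Set.mem_iUnion.2 ⟨(k, ⟨w, hw⟩), (by linarith : δ / 2 ≤ _).trans hkw⟩
    _ ≤ ∑ p, P (A p) := measure_iUnion_fintype_le _ _
    _ ≤ ∑ _ : Fin n × T, ENNReal.ofReal (ρ ^ n) := Finset.sum_le_sum fun p _ =>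
        measure_le_inner_spatialRank_sub_rankMap_le hlaw hindep p.1 (hT _ p.2.2) hn2 hn
    _ = ENNReal.ofReal (T.card * (n * ρ ^ n)) := by
        rw [Finset.sum_const, Finset.card_univ, Fintype.card_prod, Fintype.card_fin,
          Fintype.card_coe, nsmul_eq_mul, ← ENNReal.ofReal_natCast,
          ← ENNReal.ofReal_mul (Nat.cast_nonneg _)]
        congr 1
        push_cast
        ring

lemma eventually_exists_spatialRank_near [F.IsOpenPosMeasure] (hlaw : ∀ j, HasLaw (X j) F P)
    (hindep : iIndepFun X P) {E : ℕ → Set Ω} (hE : Tendsto (fun n => P (E n)) atTop (𝓝 1))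
    (z : EuclideanSpace ℝ (Fin d)) {τ : ℝ} (hτ : 0 < τ) :
    ∀ᶠ n in atTop, ∃ ω ∈ E n, ‖X 0 ω - z‖ < τ ∧
      ‖spatialRank (fun j : Fin n => X j ω) (X 0 ω) - rankMap F z‖ < 2 * τ := by
  let B := Metric.ball z τ ∩ rankMap F ⁻¹' Metric.ball (rankMap F z) τ
  have hB : MeasurableSet B :=
    measurableSet_ball.inter (measurable_rankMap F measurableSet_ball)
  have hX0 : P {ω | X 0 ω ∉ B} < 1 := by
    have hBc : P {ω | X 0 ω ∉ B} = F Bᶜ := (hlaw 0).measure_eq hB.compl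
    rw [hBc, prob_compl_eq_one_sub hB]
    exact ENNReal.sub_lt_self ENNReal.one_ne_top one_ne_zero
      (measure_ball_inter_rankMap_preimage_ball_pos F z hτ hτ).ne'
  filter_upwards [eventually_gt_atTop 0, eventually_exists_mem_notMem hX0
    (tendsto_measure_exists_le_norm_spatialRank_sub_rankMap hlaw hindep hτ) hE]
    with n hn ⟨ω, hωE, hrank, hω⟩
  obtain ⟨hXz, hRX⟩ := not_not.1 hω
  have hdev := not_le.1 (not_exists.1 hrank ⟨0, hn⟩)
  rw [Set.mem_preimage, mem_ball_iff_norm] at hRX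
  refine ⟨ω, hωE, mem_ball_iff_norm.1 hXz, ?_⟩
  linarith [norm_sub_le_norm_sub_add_norm_sub
    (spatialRank (fun j : Fin n => X j ω) (X 0 ω)) (rankMap F (X 0 ω)) (rankMap F z)]

end EmpiricalRank

section QQPlot

variable {d : ℕ}

lemma norm_le_sum_abs (v : EuclideanSpace ℝ (Fin d)) : ‖v‖ ≤ ∑ i, |v i| := by
  rw [EuclideanSpace.norm_eq]
  refine Real.sqrt_le_iff.2 ⟨Finset.sum_nonneg fun i _ => abs_nonneg _, ?_⟩
  simpa using Finset.sum_sq_le_sq_sum_of_nonneg (s := Finset.univ) (f := fun i => |v i|)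
    fun i _ => abs_nonneg _

lemma mem_lineNhd_of_abs_sub_lt {a b ε : ℝ} (h : |a - b| < ε) : !₂[a, b] ∈ lineNhd ε := by
  refine Metric.mem_thickening_iff.2 ⟨!₂[a, a], rfl, ?_⟩
  rw [EuclideanSpace.dist_eq]
  simpa [Fin.sum_univ_two, Real.sqrt_sq_eq_abs, Real.dist_eq, abs_sub_comm b a] using h

lemma abs_sub_lt_of_mem_lineNhd {a b ε : ℝ} (h : !₂[a, b] ∈ lineNhd ε) : |a - b| < 2 * ε := by
  obtain ⟨q, hq, hlt⟩ := Metric.mem_thickening_iff.1 h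
  have hdiag : q 1 = q 0 := hq
  rw [dist_eq_norm] at hlt
  have h0 : |a - q 0| < ε := (PiLp.norm_apply_le (!₂[a, b] - q) 0).trans_lt hlt
  have h1 : |b - q 0| < ε := hdiag ▸ (PiLp.norm_apply_le (!₂[a, b] - q) 1).trans_lt hlt
  linarith [abs_sub_le a (q 0) b, abs_sub_comm b (q 0)]

variable {F F₀ : Measure (EuclideanSpace ℝ (Fin d))} {n : ℕ} {x : Fin n → EuclideanSpace ℝ (Fin d)}
  {r ε : ℝ}

lemma qqPlot_subset_lineNhd
    (h : ∀ k, ‖spatialRank x (x k)‖ ≤ r → ‖x k - spatialQuantile F₀ (spatialRank x (x k))‖ < ε)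
    (i : Fin d) : qqPlot x F₀ r i ⊆ lineNhd ε := by
  rintro _ ⟨k, hk, rfl⟩
  exact mem_lineNhd_of_abs_sub_lt
    ((PiLp.norm_apply_le _ i).trans_lt (h k (mem_closedBall_zero_iff.1 hk)))

lemma norm_sub_spatialQuantile_le_of_qqPlot_subset (h : ∀ i, qqPlot x F₀ r i ⊆ lineNhd ε)
    {k : Fin n} (hk : ‖spatialRank x (x k)‖ ≤ r) :
    ‖x k - spatialQuantile F₀ (spatialRank x (x k))‖ ≤ d * (2 * ε) := by
  refine (norm_le_sum_abs _).trans ?_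
  calc _ ≤ ∑ _ : Fin d, 2 * ε := Finset.sum_le_sum fun i _ =>
        (abs_sub_lt_of_mem_lineNhd (h i ⟨k, mem_closedBall_zero_iff.2 hk, rfl⟩)).le
    _ = d * (2 * ε) := by simp

variable [IsProbabilityMeasure F] [F.IsOpenPosMeasure]
  {Ω : Type*} [MeasurableSpace Ω] {P : Measure Ω} [IsProbabilityMeasure P]
  {X : ℕ → Ω → EuclideanSpace ℝ (Fin d)}

theorem tendsto_measure_qqPlot_subset (hlaw : ∀ j, HasLaw (X j) F P) (hindep : iIndepFun X P)
    (hr : r < 1) (hε : 0 < ε) :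
    Tendsto (fun n : ℕ => P {ω | ∀ i : Fin d,
      qqPlot (fun k : Fin n => X k ω) F r i ⊆ lineNhd ε}) atTop (𝓝 1) := by
  obtain ⟨r', hrr', hr'⟩ := exists_between hr
  have huc := (isCompact_closedBall 0 r').uniformContinuousOn_of_continuous
    (continuousOn_spatialQuantile (F := F).mono (Metric.closedBall_subset_ball hr'))
  obtain ⟨δ, hδ, hQ⟩ := Metric.uniformContinuousOn_iff.1 huc ε hε
  refine tendsto_measure_one_of_compl_subset
    (tendsto_measure_exists_le_norm_spatialRank_sub_rankMap hlaw hindep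
      (lt_min hδ (sub_pos.2 hrr'))) fun n ω hω => qqPlot_subset_lineNhd fun k hk => ?_
  have hclose := not_exists.1 hω k
  rw [not_le, lt_min_iff] at hclose
  set u := spatialRank (fun j : Fin n => X j ω) (X k ω)
  have hR : ‖rankMap F (X k ω)‖ ≤ r' := by
    linarith [norm_le_insert u (rankMap F (X k ω))]
  have hdist := hQ (rankMap F (X k ω)) (mem_closedBall_zero_iff.2 hR) u
    (mem_closedBall_zero_iff.2 (hk.trans hrr'.le)) (by rw [dist_eq_norm']; exact hclose.1)
  rwa [spatialQuantile_rankMap, dist_eq_norm] at hdist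

lemma exists_spatialQuantile_near (hlaw : ∀ j, HasLaw (X j) F P) (hindep : iIndepFun X P)
    (h : ∀ r : ℝ, 0 < r → r < 1 → ∀ ε : ℝ, 0 < ε →
      Tendsto (fun n : ℕ => P {ω | ∀ i : Fin d,
        qqPlot (fun k : Fin n => X k ω) F₀ r i ⊆ lineNhd ε}) atTop (𝓝 1))
    (z : EuclideanSpace ℝ (Fin d)) {η : ℝ} (hη : 0 < η) :
    ∃ u, ‖u‖ < 1 ∧ ‖u - rankMap F z‖ < η ∧ ‖spatialQuantile F₀ u - z‖ < η := by
  obtain ⟨r, hzr, hr⟩ := exists_between ((hasSubgradientAt_rankMap F z).norm_lt_one F)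
  obtain ⟨τ, hτ, hτ_lt⟩ := exists_between (half_pos (lt_min hη (sub_pos.2 hzr)))
  obtain ⟨hτη, hτr⟩ := lt_min_iff.1 ((lt_div_iff₀' two_pos).1 hτ_lt)
  set ε := τ / (2 * (d + 1)) with hε
  have hdε : d * (2 * ε) ≤ τ := by
    rw [hε, ← mul_assoc, ← mul_div_assoc, div_le_iff₀ (by positivity)]
    nlinarith
  have hplot := h r ((norm_nonneg _).trans_lt hzr) hr ε (by positivity)
  obtain ⟨n, hn, ω, hω, hXz, hu⟩ := ((eventually_gt_atTop 0).and
    (eventually_exists_spatialRank_near hlaw hindep hplot z hτ)).exists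
  have hquantile := norm_sub_spatialQuantile_le_of_qqPlot_subset hω (k := ⟨0, hn⟩)
  dsimp only at hquantile
  set u := spatialRank (fun j : Fin n => X j ω) (X 0 ω)
  have hur : ‖u‖ < r := by linarith [norm_le_norm_add_norm_sub' u (rankMap F z)]
  refine ⟨u, hur.trans hr, hu.trans hτη, ?_⟩
  have htri := norm_sub_le_norm_sub_add_norm_sub (spatialQuantile F₀ u) (X 0 ω) z
  rw [norm_sub_rev _ (X 0 ω)] at htri
  linarith [hquantile hur.le]

variable [IsProbabilityMeasure F₀]

theorem eq_of_tendsto_measure_qqPlot_subset (hlaw : ∀ j, HasLaw (X j) F P)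
    (hindep : iIndepFun X P)
    (h : ∀ r : ℝ, 0 < r → r < 1 → ∀ ε : ℝ, 0 < ε →
      Tendsto (fun n : ℕ => P {ω | ∀ i : Fin d,
        qqPlot (fun k : Fin n => X k ω) F₀ r i ⊆ lineNhd ε}) atTop (𝓝 1)) : F = F₀ := by
  have hsub : ∀ z, HasSubgradientAt (normPotential F₀) (rankMap F z) z := fun z => by
    refine hasSubgradientAt_of_forall_exists_near (continuous_normPotential F₀) fun η hη => ?_
    obtain ⟨u, hu, hRu, hQ⟩ := exists_spatialQuantile_near hlaw hindep h z hη
    exact ⟨u, spatialQuantile F₀ u, hasSubgradientAt_spatialQuantile hu, hRu, hQ⟩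
  refine eq_of_normPotential_eq (funext fun z => ?_)
  simpa using sub_eq_sub_of_hasSubgradientAt (hasSubgradientAt_rankMap F) hsub 0 z

lemma HasPosLocBddDensity.isOpenPosMeasure {F : Measure (EuclideanSpace ℝ (Fin d))}
    (hF : HasPosLocBddDensity F) : F.IsOpenPosMeasure := by
  obtain ⟨f, hf, hpos, -, rfl⟩ := hF
  refine Measure.AbsolutelyContinuous.isOpenPosMeasure (μ := volume) ?_
  exact withDensity_absolutelyContinuous' hf.ennreal_ofReal.aemeasurable
    (ae_of_all _ fun x => (ENNReal.ofReal_pos.2 (hpos x)).ne')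

end QQPlot

end SpatialQQ

theorem theorem2p1_general {d : ℕ} (F F₀ : Measure (EuclideanSpace ℝ (Fin d)))
    [IsProbabilityMeasure F] [IsProbabilityMeasure F₀] [F.IsOpenPosMeasure]
    {Ω : Type*} [MeasurableSpace Ω] (P : Measure Ω) [IsProbabilityMeasure P]
    (X : ℕ → Ω → EuclideanSpace ℝ (Fin d))
    (hlaw : ∀ j, HasLaw (X j) F P) (hindep : iIndepFun X P) :
    (∀ r : ℝ, 0 < r → r < 1 → ∀ ε : ℝ, 0 < ε →
      Tendsto
        (fun n : ℕ => P {ω | ∀ i : Fin d,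
          SpatialQQ.qqPlot (fun k : Fin n => X k ω) F₀ r i ⊆ SpatialQQ.lineNhd ε})
        atTop (𝓝 1)) ↔
    F = F₀ := by
  refine ⟨SpatialQQ.eq_of_tendsto_measure_qqPlot_subset hlaw hindep, ?_⟩
  rintro rfl r - hr ε hε
  exact SpatialQQ.tendsto_measure_qqPlot_subset hlaw hindep hr hε

theorem theorem2p1 {d : ℕ} (hd : 2 ≤ d)
    (F F₀ : Measure (EuclideanSpace ℝ (Fin d))) [IsProbabilityMeasure F] [IsProbabilityMeasure F₀]
    (hF : SpatialQQ.HasPosLocBddDensity F) (hF₀ : SpatialQQ.HasPosLocBddDensity F₀)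
    {Ω : Type*} [MeasurableSpace Ω] (P : Measure Ω) [IsProbabilityMeasure P]
    (X : ℕ → Ω → EuclideanSpace ℝ (Fin d))
    (hlaw : ∀ j, HasLaw (X j) F P) (hindep : iIndepFun X P) :
    (∀ r : ℝ, 0 < r → r < 1 → ∀ ε : ℝ, 0 < ε →
      Tendsto
        (fun n : ℕ => P {ω | ∀ i : Fin d,
          SpatialQQ.qqPlot (fun k : Fin n => X k ω) F₀ r i ⊆ SpatialQQ.lineNhd ε})
        atTop (𝓝 1)) ↔
    F = F₀ := by
  have := hF.isOpenPosMeasure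
  exact theorem2p1_general F F₀ P X hlaw hindep
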